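/- All systems are finite-dimensional quantum systems, states are density operators and channels are completely positive trace-preserving maps. Let $k\ge 1$ and $M\ge 1$ be integers and $\varepsilon\in[0,1]$. **Definitions.** A state $\sigma_{AB}$ is $k$-extendible if there is a state $\omega_{AB_1\cdots B_k}$, with every $B_i\simeq B$, that is invariant under all permutations of $B_1,\dots,B_k$ and has marginal $\omega_{AB_1}=\sigma_{AB}$; the set of these states is $\mathrm{EXT}_k(A;B)$. A channel $\mathcal K_{AB\to A'B'}$ is $k$-extendible if there is a channel $\mathcal M_{AB_1\cdots B_k\to A'B_1'\cdots B_k'}$ that is covariant under all permutations $\pi\in S_k$, i.e. $\mathcal M\circ\mathcal W^{\pi}_{B_1\cdots B_k}=\mathcal W^{\pi}_{B'_1\cdots B'_k}\circ\mathcal M$ where $\mathcal W^\pi$ is the unitary permutation channel, and that satisfies $\mathcal K(\theta_{AB_1})=\operatorname{Tr}_{B_2'\cdots B_k'}\{\mathcal M(\theta_{AB_1\cdots B_k})\}$ for all states $\theta_{AB_1\cdots B_k}$. The hypothesis-testing divergence is $$D_h^\varepsilon(\rho\Vert\sigma)=-\log_2\inf_\Lambda\{\operatorname{Tr}\{\Lambda\sigma\}:0\le\Lambda\le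 I,\ \operatorname{Tr}\{\Lambda\rho\}\ge 1-\varepsilon\}\in[0,\infty]$$ (with $-\log_2 0=+\infty$), and $$E^\varepsilon_k(A;B)_\rho=\inf_{\sigma_{AB}\in\mathrm{EXT}_k(A;B)}D_h^\varepsilon(\rho_{AB}\Vert\sigma_{AB}).$$ Let $\Phi$ denote the maximally entangled state of Schmidt rank $M$ on two $M$-dimensional systems, and let $F(\tau,\sigma)=\Vert\sqrt\tau\sqrt\sigma\Vert_1^2$ be the fidelity. **Theorem.** (i) Let $\mathcal N_{A\to B}$ be a channel, and suppose that there is a $(1,M,\varepsilon)$ entanglement transmission protocol over $\mathcal N$ assisted by a $k$-extendible post-processing, i.e. an encoding channel $\mathcal E_{A'\to A}$ and a $k$-extendible channel $\mathcal K_{RB\to M_AM_B}$, where $R,A',M_A,M_B$ have dimension $M$, such that $$F\big(\mathcal K_{RB\to M_AM_B}(\mathcal N_{A\to B}(\mathcal E_{A'\to A}(\Phi_{RA'}))),\Phi_{M_AM_B}\big)\ge 1-\varepsilon .$$ Then $$-\log_2\Big[\frac1M+\frac1k-\frac1{Mk}\Big]\le\sup_{\psi_{RA}}E^\varepsilon_k(R;B)_{\mathcal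 N_{A\to B}(\psi_{RA})},$$ where the supremum is over the pure states $\psi_{RA}$ with $R\simeq A$. (ii) Let $\rho_{AB}$ be a state, and suppose that there is a $(1,M,\varepsilon)$ entanglement distillation protocol for $\rho_{AB}$ assisted by a $k$-extendible post-processing, i.e. a $k$-extendible channel $\mathcal K_{AB\to M_AM_B}$ such that $F(\mathcal K_{AB\to M_AM_B}(\rho_{AB}),\Phi_{M_AM_B})\ge 1-\varepsilon$. Then $$-\log_2\Big[\frac1M+\frac1k-\frac1{Mk}\Big]\le E^\varepsilon_k(A;B)_\rho .$$ -/

import Mathlib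

open scoped MatrixOrder ComplexOrder

noncomputable section

namespace QInfo

/-- A finite-dimensional quantum system is described by a finite index type labelling a fixed
orthonormal basis; a density operator is a positive semidefinite matrix of unit trace. -/
def IsState {a : Type*} [Fintype a] (ρ : Matrix a a ℂ) : Prop :=
  ρ.PosSemidef ∧ ρ.trace = 1

/-- A pure state: the rank-one density operator of a unit vector. -/
def IsPureState {a : Type*} [Fintype a] (ρ : Matrix a a ℂ) : Prop :=
  ∃ v : a → ℂ, ∑ i, ‖v i‖ ^ 2 = 1 ∧ ρ = Matrix.vecMulVec v (star v)

/-- `(id_R ⊗ N)(X)`, i.e. `N` applied to every block of `X`. -/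
def applyRight {r a b : Type*} (N : Matrix a a ℂ →ₗ[ℂ] Matrix b b ℂ)
    (X : Matrix (r × a) (r × a) ℂ) : Matrix (r × b) (r × b) ℂ :=
  Matrix.of fun i j => N (Matrix.of fun x y => X (i.1, x) (j.1, y)) i.2 j.2

/-- Complete positivity: `id_n ⊗ N` preserves positive semidefiniteness for every `n`. -/
def IsCompletelyPositive {a b : Type*} [Fintype a] [Fintype b]
    (N : Matrix a a ℂ →ₗ[ℂ] Matrix b b ℂ) : Prop :=
  ∀ (n : ℕ) (X : Matrix (Fin n × a) (Fin n × a) ℂ), X.PosSemidef → (applyRight N X).PosSemidef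

/-- A quantum channel: a completely positive trace-preserving linear map. -/
def IsChannel {a b : Type*} [Fintype a] [Fintype b]
    (N : Matrix a a ℂ →ₗ[ℂ] Matrix b b ℂ) : Prop :=
  IsCompletelyPositive N ∧ ∀ X, (N X).trace = X.trace

/-- The unitary permutation channel `𝒲^π` permuting the `k` copies of `B` in `A B₁ ⋯ B_k`:
conjugation by the unitary `|x⟩|f⟩ ↦ |x⟩|f ∘ π⁻¹⟩`. -/
def permuteB {a b : Type*} {k : ℕ} (π : Equiv.Perm (Fin k))
    (ω : Matrix (a × (Fin k → b)) (a × (Fin k → b)) ℂ) :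
    Matrix (a × (Fin k → b)) (a × (Fin k → b)) ℂ :=
  ω.submatrix (fun p => (p.1, p.2 ∘ π)) (fun p => (p.1, p.2 ∘ π))

/-- The marginal on `A B₁` of an operator on `A B₁ ⋯ B_k`: the partial trace over `B₂ ⋯ B_k`
(the copy `B₁` carries the index `0 : Fin k`). -/
def marginalAB {a b : Type*} [Fintype b] [DecidableEq b] {k : ℕ} [NeZero k]
    (ω : Matrix (a × (Fin k → b)) (a × (Fin k → b)) ℂ) : Matrix (a × b) (a × b) ℂ :=
  Matrix.of fun p q =>
    ∑ f : Fin k → b, if f 0 = p.2 then ω (p.1, f) (q.1, Function.update f 0 q.2) else 0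

/-- The set `EXT_k(A;B)` of `k`-extendible states. -/
def EXT (a b : Type*) [Fintype a] [Fintype b] [DecidableEq b] (k : ℕ) [NeZero k] :
    Set (Matrix (a × b) (a × b) ℂ) :=
  {ρ | IsState ρ ∧ ∃ ω : Matrix (a × (Fin k → b)) (a × (Fin k → b)) ℂ,
    IsState ω ∧ (∀ π : Equiv.Perm (Fin k), permuteB π ω = ω) ∧ marginalAB ω = ρ}

/-- `k`-extendible bipartite channels `AB → A'B'`: there is a channel
`A B₁ ⋯ B_k → A' B'₁ ⋯ B'_k` that is permutation covariant and has `N` as its marginal. -/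
def IsKExtendibleChannel {a b a' b' : Type*} [Fintype a] [Fintype b] [DecidableEq b]
    [Fintype a'] [Fintype b'] [DecidableEq b'] (k : ℕ) [NeZero k]
    (N : Matrix (a × b) (a × b) ℂ →ₗ[ℂ] Matrix (a' × b') (a' × b') ℂ) : Prop :=
  IsChannel N ∧
  ∃ M : Matrix (a × (Fin k → b)) (a × (Fin k → b)) ℂ →ₗ[ℂ]
      Matrix (a' × (Fin k → b')) (a' × (Fin k → b')) ℂ,
    IsChannel M ∧
    (∀ (π : Equiv.Perm (Fin k)) (θ : Matrix (a × (Fin k → b)) (a × (Fin k → b)) ℂ),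
      IsState θ → M (permuteB π θ) = permuteB π (M θ)) ∧
    (∀ θ : Matrix (a × (Fin k → b)) (a × (Fin k → b)) ℂ,
      IsState θ → N (marginalAB θ) = marginalAB (M θ))

/-- The trace norm `‖X‖₁ = Tr √(X† X)`. -/
def traceNorm {a : Type*} [Fintype a] [DecidableEq a] (X : Matrix a a ℂ) : ℝ :=
  (CFC.sqrt (X.conjTranspose * X)).trace.re

/-- The fidelity `F(τ, σ) = ‖√τ √σ‖₁²`. -/
def fidelity {a : Type*} [Fintype a] [DecidableEq a] (τ σ : Matrix a a ℂ) : ℝ :=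
  traceNorm (CFC.sqrt τ * CFC.sqrt σ) ^ 2

/-- The maximally entangled state `Φ` of Schmidt rank `M`:
`Φ = (1/M) ∑_{i,j} |i⟩|i⟩⟨j|⟨j|`. -/
def maxEntangled (M : ℕ) : Matrix (Fin M × Fin M) (Fin M × Fin M) ℂ :=
  Matrix.of fun p q => if p.1 = p.2 ∧ q.1 = q.2 then (M : ℂ)⁻¹ else 0

/-- `-log₂ x` for `x ≥ 0`, with the value `+∞` at `x = 0`. -/
def negLog2 (x : ℝ) : EReal :=
  if x = 0 then ⊤ else ((-Real.logb 2 x : ℝ) : EReal)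

/-- The `ε`-hypothesis-testing divergence
`D_h^ε(ρ‖σ) = -log₂ inf {Tr(Λσ) : 0 ≤ Λ ≤ I, Tr(Λρ) ≥ 1 - ε}`. -/
def hypTestDiv {a : Type*} [Fintype a] [DecidableEq a] (ε : ℝ) (ρ σ : Matrix a a ℂ) : EReal :=
  negLog2 (sInf {t : ℝ | ∃ Λ : Matrix a a ℂ, Λ.PosSemidef ∧ (1 - Λ).PosSemidef ∧
    1 - ε ≤ (Λ * ρ).trace.re ∧ t = (Λ * σ).trace.re})

/-- The `k`-unextendible `ε`-hypothesis-testing divergence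
`E_k^ε(A;B)_ρ = inf_{σ ∈ EXT_k(A;B)} D_h^ε(ρ‖σ)`. -/
def unextDiv {a b : Type*} [Fintype a] [DecidableEq a] [Fintype b] [DecidableEq b]
    (k : ℕ) [NeZero k] (ε : ℝ) (ρ : Matrix (a × b) (a × b) ℂ) : EReal :=
  ⨅ σ ∈ EXT a b k, hypTestDiv ε ρ σ

/-- A `(1, M, ε)` entanglement transmission protocol over the channel `N : A → B` assisted by a
`k`-extendible post-processing: an encoding channel `E : A' → A` acting on the second half of the
maximally entangled state `Φ_{RA'}`, followed (after `N`) by a `k`-extendible channel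
`K : RB → M_A M_B`, such that the final state has fidelity at least `1 - ε` with `Φ`. -/
def IsTransmissionProtocol {a b : Type*} [Fintype a] [Fintype b] [DecidableEq b]
    (k : ℕ) [NeZero k] (M : ℕ) (ε : ℝ) (N : Matrix a a ℂ →ₗ[ℂ] Matrix b b ℂ)
    (E : Matrix (Fin M) (Fin M) ℂ →ₗ[ℂ] Matrix a a ℂ)
    (K : Matrix (Fin M × b) (Fin M × b) ℂ →ₗ[ℂ]
      Matrix (Fin M × Fin M) (Fin M × Fin M) ℂ) : Prop :=
  IsChannel E ∧ IsKExtendibleChannel k K ∧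
    1 - ε ≤ fidelity (K (applyRight N (applyRight E (maxEntangled M)))) (maxEntangled M)

/-- A `(1, M, ε)` entanglement distillation protocol for the state `ρ_{AB}` assisted by a
`k`-extendible post-processing `K : AB → M_A M_B`. -/
def IsDistillationProtocol {a b : Type*} [Fintype a] [Fintype b] [DecidableEq b]
    (k : ℕ) [NeZero k] (M : ℕ) (ε : ℝ) (ρ : Matrix (a × b) (a × b) ℂ)
    (K : Matrix (a × b) (a × b) ℂ →ₗ[ℂ]
      Matrix (Fin M × Fin M) (Fin M × Fin M) ℂ) : Prop :=
  IsKExtendibleChannel k K ∧ 1 - ε ≤ fidelity (K ρ) (maxEntangled M)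

end QInfo

end

namespace QInfo

open Matrix

/-! Both parts use one test: post-process, then measure the projection `Φ`. For the protocol's state
it accepts with probability equal to the fidelity, because `Φ` is a rank-one projection. A
k-extendible post-processing maps a k-extendible input to a k-extendible output, so the type II
error is bounded by the largest overlap of such an operator with `Φ`.

By symmetry that overlap is the average over `i` of the overlaps of the extension with `Φ_{AB_i}`.
Distinct projections `Φ_{AB_i}`, `Φ_{AB_j}` interact only at strength `1/M`, so `∑ᵢ Φ_{AB_i} ≤ 1 +
(k - 1)/M` (`sum_overlap_form_le`). Dividing by `k` gives `1/M + 1/k - 1/(Mk)`.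

In part (i) the encoded state may be mixed and its reference has dimension `M`, while the supremum
is over pure states with `R ≃ A`. By `exists_pure_leftMap_eq` the encoded state is the image of such
a pure state under a trace-nonincreasing map on the reference. That map commutes with the channel
and preserves extendibility, so it is absorbed into the test. -/

/-! ### Positivity and the trace pairing -/

theorem exists_eq_conjTranspose_mul_self {n : Type*} [Fintype n] [DecidableEq n]
    {A : Matrix n n ℂ} (hA : A.PosSemidef) : ∃ B : Matrix n n ℂ, A = Bᴴ * B :=
  ⟨CFC.sqrt A, by
    rw [(nonneg_iff_posSemidef.mp (CFC.sqrt_nonneg A)).isHermitian.eq,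
      CFC.sqrt_mul_sqrt_self A hA.nonneg]⟩

theorem trace_mul_nonneg {n : Type*} [Fintype n] [DecidableEq n]
    {A B : Matrix n n ℂ} (hA : A.PosSemidef) (hB : B.PosSemidef) : 0 ≤ (A * B).trace := by
  obtain ⟨C, rfl⟩ := exists_eq_conjTranspose_mul_self hA
  rw [Matrix.mul_assoc, Matrix.trace_mul_comm]
  exact (hB.mul_mul_conjTranspose_same C).trace_nonneg

/-- Nonnegativity in the order of `ℂ` makes the quadratic form real, and over `ℂ` a real form forces
the matrix to be Hermitian. -/
theorem posSemidef_of_forall_nonneg {n : Type*} [Fintype n] [DecidableEq n]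
    {A : Matrix n n ℂ} (h : ∀ x : n → ℂ, 0 ≤ star x ⬝ᵥ A *ᵥ x) : A.PosSemidef := by
  refine PosSemidef.of_dotProduct_mulVec_nonneg ?_ h
  rw [← isSymmetric_toEuclideanLin_iff, LinearMap.isSymmetric_iff_inner_map_self_real]
  intro v
  have h1 := h v.ofLp
  have h2 : inner ℂ (toEuclideanLin A v) v = star (star v.ofLp ⬝ᵥ A *ᵥ v.ofLp) := by
    rw [star_dotProduct, star_star, dotProduct_comm, EuclideanSpace.inner_eq_star_dotProduct]
    simp [toEuclideanLin]
  rw [h2]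
  have h3 := (Complex.nonneg_iff.mp h1).2
  apply Complex.ext
  · simp
  · simp [← h3]

/-- The matrix representing a linear functional through the trace pairing. -/
noncomputable def traceRep {n : Type*} [DecidableEq n] (f : Matrix n n ℂ →ₗ[ℂ] ℂ) :
    Matrix n n ℂ :=
  Matrix.of fun i j => f (Matrix.single j i 1)

theorem trace_traceRep_mul {n : Type*} [Fintype n] [DecidableEq n] (f : Matrix n n ℂ →ₗ[ℂ] ℂ)
    (X : Matrix n n ℂ) : (traceRep f * X).trace = f X := by
  conv_rhs => rw [matrix_eq_sum_single X]
  simp only [Matrix.trace, Matrix.diag, Matrix.mul_apply, traceRep, Matrix.of_apply, map_sum]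
  rw [Finset.sum_comm]
  refine Finset.sum_congr rfl fun i _ => Finset.sum_congr rfl fun j _ => ?_
  have : Matrix.single i j (X i j) = X i j • Matrix.single i j (1 : ℂ) := by simp
  rw [this, map_smul, smul_eq_mul, mul_comm]

theorem dotProduct_mulVec_eq_trace {n : Type*} [Fintype n] (A : Matrix n n ℂ) (x : n → ℂ) :
    star x ⬝ᵥ A *ᵥ x = (A * vecMulVec x (star x)).trace := by
  rw [Matrix.mul_vecMulVec, Matrix.trace_vecMulVec, dotProduct_comm]

theorem posSemidef_of_trace_nonneg {n : Type*} [Fintype n] [DecidableEq n] {A : Matrix n n ℂ}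
    (h : ∀ X : Matrix n n ℂ, X.PosSemidef → 0 ≤ (A * X).trace) : A.PosSemidef :=
  posSemidef_of_forall_nonneg fun x => by
    rw [dotProduct_mulVec_eq_trace]
    exact h _ (posSemidef_vecMulVec_self_star x)

/-! ### The maximally entangled state and its fidelity -/

theorem trace_maxEntangled_mul {M : ℕ} (X : Matrix (Fin M × Fin M) (Fin M × Fin M) ℂ) :
    (maxEntangled M * X).trace = (M : ℂ)⁻¹ * ∑ x, ∑ y, X (x, x) (y, y) := by
  simp only [Matrix.trace, Matrix.diag, Matrix.mul_apply, maxEntangled, Matrix.of_apply,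
    Fintype.sum_prod_type, ite_and, ite_mul, zero_mul, Finset.mul_sum]
  simp only [Finset.sum_ite_irrel, Finset.sum_const_zero, Finset.sum_ite_eq, Finset.mem_univ,
    if_true]
  rw [Finset.sum_comm]

/-- The unit vector whose projection is `maxEntangled M`. -/
noncomputable def maxEntangledVec (M : ℕ) : Fin M × Fin M → ℂ :=
  fun p => if p.1 = p.2 then ((Real.sqrt M)⁻¹ : ℝ) else 0

theorem maxEntangled_eq_vecMulVec (M : ℕ) :
    maxEntangled M = vecMulVec (maxEntangledVec M) (star (maxEntangledVec M)) := by
  have h : ((Real.sqrt M : ℝ) : ℂ) * ((Real.sqrt M : ℝ) : ℂ) = M := by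
    rw [← Complex.ofReal_mul, Real.mul_self_sqrt (Nat.cast_nonneg M)]; simp
  ext p q
  simp only [maxEntangled, vecMulVec, maxEntangledVec, Matrix.of_apply, Pi.star_apply]
  by_cases h1 : p.1 = p.2 <;> by_cases h2 : q.1 = q.2 <;> simp [h1, h2]
  rw [← mul_inv, h]

theorem star_maxEntangledVec_dotProduct {M : ℕ} (hM : 1 ≤ M) :
    star (maxEntangledVec M) ⬝ᵥ maxEntangledVec M = 1 := by
  have h : ((Real.sqrt M : ℝ) : ℂ) * ((Real.sqrt M : ℝ) : ℂ) = M := by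
    rw [← Complex.ofReal_mul, Real.mul_self_sqrt (Nat.cast_nonneg M)]; simp
  have hM' : (M : ℂ) ≠ 0 := by exact_mod_cast (by omega : M ≠ 0)
  simp only [dotProduct, maxEntangledVec, Pi.star_apply, Fintype.sum_prod_type]
  simp [apply_ite, ← mul_inv, h, hM']

theorem posSemidef_maxEntangled (M : ℕ) : (maxEntangled M).PosSemidef := by
  rw [maxEntangled_eq_vecMulVec]
  exact posSemidef_vecMulVec_self_star _

theorem trace_maxEntangled {M : ℕ} (hM : 1 ≤ M) : (maxEntangled M).trace = 1 := by
  rw [maxEntangled_eq_vecMulVec, Matrix.trace_vecMulVec, dotProduct_comm,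
    star_maxEntangledVec_dotProduct hM]

theorem maxEntangled_mul_mul {M : ℕ} (X : Matrix (Fin M × Fin M) (Fin M × Fin M) ℂ) :
    maxEntangled M * X * maxEntangled M = (maxEntangled M * X).trace • maxEntangled M := by
  rw [maxEntangled_eq_vecMulVec, Matrix.vecMulVec_mul, Matrix.vecMulVec_mul_vecMulVec,
    Matrix.trace_vecMulVec, dotProduct_comm]
  ext i j
  simp [vecMulVec]
  ring

theorem maxEntangled_mul_self {M : ℕ} (hM : 1 ≤ M) :
    maxEntangled M * maxEntangled M = maxEntangled M := by
  have := maxEntangled_mul_mul (M := M) 1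
  simpa [trace_maxEntangled hM] using this

/-- `Φ` is a rank-one projection, so `√Φ = Φ` and `(√τ Φ)ᴴ (√τ Φ) = Φ τ Φ = t Φ` with `t = Tr Φτ`;
its root `√t Φ` has trace `√t`. -/
theorem fidelity_maxEntangled {M : ℕ} (hM : 1 ≤ M)
    {τ : Matrix (Fin M × Fin M) (Fin M × Fin M) ℂ} (hτ : τ.PosSemidef) :
    fidelity τ (maxEntangled M) = (maxEntangled M * τ).trace.re := by
  have hΦ := posSemidef_maxEntangled M
  have ht := trace_mul_nonneg hΦ hτ
  set t := (maxEntangled M * τ).trace with ht_def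
  have hre : t = ((t.re : ℝ) : ℂ) := Complex.ext rfl (by simpa using (Complex.nonneg_iff.mp ht).2.symm)
  have ht0 : 0 ≤ t.re := (Complex.nonneg_iff.mp ht).1
  have hsΦ : CFC.sqrt (maxEntangled M) = maxEntangled M :=
    CFC.sqrt_unique (maxEntangled_mul_self hM) hΦ.nonneg
  have hsτ : (CFC.sqrt τ)ᴴ = CFC.sqrt τ :=
    (nonneg_iff_posSemidef.mp (CFC.sqrt_nonneg τ)).isHermitian.eq
  have h1 : (CFC.sqrt τ * maxEntangled M)ᴴ * (CFC.sqrt τ * maxEntangled M)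
      = t • maxEntangled M := by
    rw [Matrix.conjTranspose_mul, hsτ, hΦ.isHermitian.eq, Matrix.mul_assoc,
      ← Matrix.mul_assoc (CFC.sqrt τ), CFC.sqrt_mul_sqrt_self τ hτ.nonneg, ← Matrix.mul_assoc,
      maxEntangled_mul_mul]
  have h2 : CFC.sqrt (t • maxEntangled M) = ((Real.sqrt t.re : ℝ) : ℂ) • maxEntangled M := by
    refine CFC.sqrt_unique ?_ ?_
    · rw [smul_mul_smul_comm, maxEntangled_mul_self hM, ← Complex.ofReal_mul,
        Real.mul_self_sqrt ht0, ← hre]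
    · exact (hΦ.smul (by exact_mod_cast Real.sqrt_nonneg t.re)).nonneg
  rw [fidelity, traceNorm, hsΦ, h1, h2, Matrix.trace_smul, trace_maxEntangled hM]
  simp [Real.sq_sqrt ht0]

/-! ### From tests to the divergence; basic facts on channels -/

/-- A test `f` with type I error at most `ε` on `ρ`, and type II error at most `c` against every
`k`-extendible state, bounds the unextendible divergence from below. -/
theorem le_unextDiv_of_test {a b : Type*} [Fintype a] [DecidableEq a] [Fintype b] [DecidableEq b]
    (k : ℕ) [NeZero k] {ε c : ℝ} {ρ : Matrix (a × b) (a × b) ℂ}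
    (f : Matrix (a × b) (a × b) ℂ →ₗ[ℂ] ℂ)
    (hf0 : ∀ X : Matrix (a × b) (a × b) ℂ, X.PosSemidef → 0 ≤ f X)
    (hf1 : ∀ X : Matrix (a × b) (a × b) ℂ, X.PosSemidef → f X ≤ X.trace)
    (hρ : 1 - ε ≤ (f ρ).re) (hσ : ∀ σ ∈ EXT a b k, (f σ).re ≤ c) :
    ((-Real.logb 2 c : ℝ) : EReal) ≤ unextDiv k ε ρ := by
  refine le_iInf₂ fun σ hmem => ?_
  unfold hypTestDiv
  set S := {t : ℝ | ∃ Λ : Matrix (a × b) (a × b) ℂ, Λ.PosSemidef ∧ (1 - Λ).PosSemidef ∧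
    1 - ε ≤ (Λ * ρ).trace.re ∧ t = (Λ * σ).trace.re}
  have hnn : ∀ t ∈ S, 0 ≤ t := by
    rintro t ⟨Λ, hΛ, -, -, rfl⟩
    exact (Complex.nonneg_iff.mp (trace_mul_nonneg hΛ hmem.1.1)).1
  -- Through the trace pairing, a positive functional dominated by the trace is an operator `0 ≤ Λ ≤
  -- 1`.
  have hS : (f σ).re ∈ S := by
    refine ⟨traceRep f, posSemidef_of_trace_nonneg fun X hX => ?_,
      posSemidef_of_trace_nonneg fun X hX => ?_, ?_, ?_⟩
    · rw [trace_traceRep_mul]; exact hf0 X hX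
    · rw [Matrix.sub_mul, Matrix.trace_sub, Matrix.one_mul, trace_traceRep_mul, sub_nonneg]
      exact hf1 X hX
    · rwa [trace_traceRep_mul]
    · rw [trace_traceRep_mul]
  have hle : sInf S ≤ c := (csInf_le ⟨0, hnn⟩ hS).trans (hσ σ hmem)
  have h0 : 0 ≤ sInf S := Real.sInf_nonneg hnn
  unfold negLog2
  -- An infimum equal to `0` gives the value `⊤`; otherwise `0 < sInf S ≤ c` and the logarithm is
  -- monotone.
  split_ifs with h
  · exact le_top
  · rw [EReal.coe_le_coe_iff, neg_le_neg_iff]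
    exact Real.logb_le_logb_of_le (by norm_num) (lt_of_le_of_ne h0 (Ne.symm h)) hle

theorem IsCompletelyPositive.posSemidef {a b : Type*} [Fintype a] [Fintype b]
    {N : Matrix a a ℂ →ₗ[ℂ] Matrix b b ℂ} (hN : IsCompletelyPositive N) {X : Matrix a a ℂ}
    (hX : X.PosSemidef) : (N X).PosSemidef :=
  (hN 1 _ (hX.submatrix Prod.snd)).submatrix fun x => (0, x)

theorem trace_applyRight {r a b : Type*} [Fintype r] [Fintype a] [Fintype b]
    {N : Matrix a a ℂ →ₗ[ℂ] Matrix b b ℂ} (hN : ∀ X, (N X).trace = X.trace)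
    (X : Matrix (r × a) (r × a) ℂ) : (applyRight N X).trace = X.trace := by
  simp only [Matrix.trace, Matrix.diag, Fintype.sum_prod_type, applyRight, Matrix.of_apply]
  refine Finset.sum_congr rfl fun i _ => ?_
  simpa [Matrix.trace] using hN (Matrix.of fun x y => X (i, x) (i, y))

/-! ### Overlap of extendible operators with the maximally entangled state -/

/-- Exchanging `f i` with `y` is an involution of the pairs `(f, y)`. -/
theorem sum_sum_update {ι b β : Type*} [Fintype ι] [DecidableEq ι] [Fintype b] [AddCommMonoid β]
    (i : ι) (F : (ι → b) → β) :
    ∑ f : ι → b, ∑ y, F (Function.update f i y) = Fintype.card b • ∑ f, F f := by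
  classical
  let e : (ι → b) × b ≃ (ι → b) × b :=
    { toFun := fun p => (Function.update p.1 i p.2, p.1 i)
      invFun := fun p => (Function.update p.1 i p.2, p.1 i)
      left_inv := fun p => by simp
      right_inv := fun p => by simp }
  rw [← Fintype.sum_prod_type']
  refine (e.sum_comp fun p => F p.1).trans ?_
  rw [Fintype.sum_prod_type]
  simp [Finset.smul_sum]

/-- `M ⟨Φ_{A B_i}, ω⟩`, the unnormalised overlap of the marginal on `A B_i` with the maximally
entangled state. -/
noncomputable def overlap {b : Type*} [Fintype b] {k : ℕ} (i : Fin k)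
    (ω : Matrix (b × (Fin k → b)) (b × (Fin k → b)) ℂ) : ℂ :=
  ∑ f : Fin k → b, ∑ y, ω (f i, f) (y, Function.update f i y)

theorem overlap_zero_permuteB {b : Type*} [Fintype b] {k : ℕ} [NeZero k]
    (π : Equiv.Perm (Fin k)) (ω : Matrix (b × (Fin k → b)) (b × (Fin k → b)) ℂ) :
    overlap 0 (permuteB π ω) = overlap (π.symm 0) ω := by
  unfold overlap permuteB
  conv_rhs => rw [← (Equiv.arrowCongr π.symm (Equiv.refl b)).sum_comp]
  refine Finset.sum_congr rfl fun f _ => Finset.sum_congr rfl fun y _ => ?_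
  have h : (Equiv.arrowCongr π.symm (Equiv.refl b)) f = f ∘ π := by ext; simp
  simp [h, Function.update_comp_equiv]

theorem trace_maxEntangled_mul_marginalAB {M k : ℕ} [NeZero k]
    (ω : Matrix (Fin M × (Fin k → Fin M)) (Fin M × (Fin k → Fin M)) ℂ) :
    (maxEntangled M * marginalAB ω).trace = (M : ℂ)⁻¹ * overlap 0 ω := by
  rw [trace_maxEntangled_mul]
  simp only [marginalAB, Matrix.of_apply, overlap]
  congr 1
  calc _ = ∑ x, ∑ f : Fin k → Fin M, if f 0 = x then
        ∑ y, ω (x, f) (y, Function.update f 0 y) else 0 := by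
        refine Finset.sum_congr rfl fun x _ => ?_
        rw [Finset.sum_comm]
        exact Finset.sum_congr rfl fun f _ => by split_ifs <;> simp
    _ = _ := by
        rw [Finset.sum_comm]
        simp

/-- The (unnormalised) pairing of `v` with the maximally entangled vector on `A B_i`. -/
noncomputable def contract {b : Type*} [Fintype b] {k : ℕ} (v : b × (Fin k → b) → ℂ)
    (i : Fin k) (f : Fin k → b) : ℂ :=
  ∑ y, v (y, Function.update f i y)

theorem contract_update {b : Type*} [Fintype b] {k : ℕ} (v : b × (Fin k → b) → ℂ)
    (i : Fin k) (f : Fin k → b) (y : b) :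
    contract v i (Function.update f i y) = contract v i f := by
  simp [contract]

/-- `contract v i` ignores the `i`-th coordinate, so averaging over that coordinate turns the `v`
factor into a second contraction. This is `⟨v, Pv⟩ = ‖Pv‖²` for the projection `P = Φ_{AB_i}`, up to
normalisation. -/
theorem card_mul_sum_star_mul_contract {b : Type*} [Fintype b] {k : ℕ}
    (v : b × (Fin k → b) → ℂ) (i : Fin k) :
    (Fintype.card b : ℂ) * ∑ f : Fin k → b, star (v (f i, f)) * contract v i f
      = ((∑ f : Fin k → b, ‖contract v i f‖ ^ 2 : ℝ) : ℂ) := by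
  rw [← nsmul_eq_mul, ← sum_sum_update i]
  push_cast
  refine Finset.sum_congr rfl fun f _ => ?_
  simp only [contract_update, Function.update_self]
  rw [← Finset.sum_mul, ← Complex.conj_mul', contract, map_sum]
  simp

/-- For `j ≠ i`, the condition `f i = f j` only fixes the coordinate that the contraction ignores,
which costs a factor `1/M`. This is the source of the weak interaction between distinct `Φ_{AB_i}`.
-/
theorem card_mul_sum_eq_mul_norm_contract {b : Type*} [Fintype b] [DecidableEq b] {k : ℕ}
    (v : b × (Fin k → b) → ℂ) {i j : Fin k} (hij : i ≠ j) :
    (Fintype.card b : ℝ) * ∑ f : Fin k → b, (if f i = f j then ‖contract v i f‖ ^ 2 else 0)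
      = ∑ f : Fin k → b, ‖contract v i f‖ ^ 2 := by
  rw [← nsmul_eq_mul, ← sum_sum_update i]
  refine Finset.sum_congr rfl fun f _ => ?_
  simp [contract_update, Function.update_of_ne hij.symm]

/-- Cauchy–Schwarz over the indices satisfying `p` only; the double sum encodes their number. -/
theorem norm_sum_ite_sq_le {ι : Type*} [Fintype ι] (p : ι → Prop) [DecidablePred p] (u : ι → ℂ) :
    ‖∑ i, if p i then u i else 0‖ ^ 2
      ≤ ∑ i, ∑ j, if p i ∧ p j then ‖u i‖ ^ 2 else 0 := by
  rw [← Finset.sum_filter]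
  calc _ ≤ (∑ i with p i, ‖u i‖) ^ 2 := by gcongr; exact norm_sum_le _ _
    _ ≤ _ := sq_sum_le_card_mul_sum_sq
    _ = _ := by
      rw [Finset.mul_sum, Finset.sum_filter]
      refine Finset.sum_congr rfl fun i _ => ?_
      by_cases h : p i <;> simp [h, ← Finset.sum_filter]

/-- The operator `∑ᵢ Φ_{A B_i}` is at most `1 + (k - 1) / M`, as a quadratic form. -/
theorem sum_overlap_form_le {b : Type*} [Fintype b] [DecidableEq b] [Nonempty b] {k : ℕ} [NeZero k]
    (v : b × (Fin k → b) → ℂ) :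
    (∑ i, ∑ f : Fin k → b, star (v (f i, f)) * contract v i f).re
      ≤ (Fintype.card b + k - 1) * ∑ p, ‖v p‖ ^ 2 := by
  set m : ℝ := (Fintype.card b : ℝ) with hm
  have hm0 : 0 < m := by rw [hm]; exact_mod_cast Fintype.card_pos
  have hm1 : 1 ≤ m := by rw [hm]; exact_mod_cast Fintype.card_pos
  have hk : (1 : ℝ) ≤ k := by exact_mod_cast NeZero.one_le
  set u := contract v
  set A := (∑ i, ∑ f : Fin k → b, star (v (f i, f)) * u i f).re with hA
  -- `w = Gv` with `G = m ∑ᵢ Φ_{AB_i}`, so that `A = ⟨v, Gv⟩`.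
  set w : b × (Fin k → b) → ℂ := fun p => ∑ i, if p.2 i = p.1 then u i p.2 else 0 with hw
  have hAw : A = (∑ p, star (v p) * w p).re := by
    rw [hA, Fintype.sum_prod_type_right]
    congr 1
    rw [Finset.sum_comm]
    refine Finset.sum_congr rfl fun f _ => ?_
    simp only [hw, Finset.mul_sum, mul_ite, mul_zero]
    rw [Finset.sum_comm]
    simp
  have hAu : m * A = ∑ i, ∑ f : Fin k → b, ‖u i f‖ ^ 2 := by
    have h := congrArg Complex.re (Finset.sum_congr rfl
      fun i (_ : i ∈ Finset.univ) => card_mul_sum_star_mul_contract v i)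
    rw [← Finset.mul_sum, ← Complex.ofReal_sum, Complex.ofReal_re, ← Complex.ofReal_natCast,
      Complex.re_ofReal_mul] at h
    exact h
  -- This is `G² ≤ (m + k - 1) G` as a quadratic form: a pair `(i, j)` has weight `1` if `i = j` and
  -- `m⁻¹` otherwise.
  have hww : ∑ p, ‖w p‖ ^ 2 ≤ (m + k - 1) * A := by
    have h1 : ∀ i j : Fin k, ∑ f : Fin k → b, (if f i = f j then ‖u i f‖ ^ 2 else 0)
        = (if i = j then 1 - m⁻¹ else 0) * ∑ f, ‖u i f‖ ^ 2 + m⁻¹ * ∑ f, ‖u i f‖ ^ 2 := by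
      intro i j
      split_ifs with h
      · subst h; simp; ring
      · rw [← card_mul_sum_eq_mul_norm_contract v h, ← hm]
        field_simp
        simp [u]
    calc ∑ p, ‖w p‖ ^ 2
        ≤ ∑ p : b × (Fin k → b), ∑ i, ∑ j, if p.2 i = p.1 ∧ p.2 j = p.1 then ‖u i p.2‖ ^ 2 else 0 :=
          Finset.sum_le_sum fun p _ => norm_sum_ite_sq_le (fun i => p.2 i = p.1) (fun i => u i p.2)
      _ = ∑ i, ∑ j, ∑ f : Fin k → b, (if f i = f j then ‖u i f‖ ^ 2 else 0) := by
          rw [Finset.sum_comm]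
          refine Finset.sum_congr rfl fun i _ => ?_
          rw [Finset.sum_comm]
          refine Finset.sum_congr rfl fun j _ => ?_
          rw [Fintype.sum_prod_type_right]
          refine Finset.sum_congr rfl fun f _ => ?_
          simp only [ite_and]
          simp [eq_comm]
      _ = ((1 - m⁻¹) + k * m⁻¹) * ∑ i, ∑ f, ‖u i f‖ ^ 2 := by
          rw [Finset.mul_sum]
          refine Finset.sum_congr rfl fun i _ => ?_
          simp only [h1, Finset.sum_add_distrib, ← Finset.sum_mul]
          simp [add_mul, mul_assoc]
      _ = (m + k - 1) * A := by
          rw [← hAu]; field_simp; ring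
  set c := m + k - 1
  have hc : 0 < c := by simp only [c]; linarith
  -- Expanding `‖Gv - cv‖² ≥ 0` and using `‖Gv‖² ≤ cA` gives `cA ≤ c²‖v‖²`.
  have h0 : 0 ≤ ∑ p, ‖w p - c * v p‖ ^ 2 := Finset.sum_nonneg fun _ _ => by positivity
  have h1 : ∑ p, ‖w p - c * v p‖ ^ 2
      = ∑ p, ‖w p‖ ^ 2 - 2 * c * A + c ^ 2 * ∑ p, ‖v p‖ ^ 2 := by
    rw [hAw, Complex.re_sum, Finset.mul_sum, Finset.mul_sum, ← Finset.sum_sub_distrib,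
      ← Finset.sum_add_distrib]
    refine Finset.sum_congr rfl fun p _ => ?_
    simp only [← Complex.normSq_eq_norm_sq, Complex.normSq_apply]
    simp
    ring
  have h2 : c * A ≤ c * (c * ∑ p, ‖v p‖ ^ 2) := by nlinarith
  exact le_of_mul_le_mul_left h2 hc

theorem sum_overlap_le {b : Type*} [Fintype b] [DecidableEq b] [Nonempty b] {k : ℕ} [NeZero k]
    {ω : Matrix (b × (Fin k → b)) (b × (Fin k → b)) ℂ} (hω : ω.PosSemidef) :
    (∑ i, overlap i ω).re ≤ (Fintype.card b + k - 1) * ω.trace.re := by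
  obtain ⟨B, rfl⟩ := exists_eq_conjTranspose_mul_self hω
  have h1 : ∑ i, overlap i (Bᴴ * B)
      = ∑ l, ∑ i, ∑ f : Fin k → b, star (B l (f i, f)) * contract (B l) i f := by
    rw [Finset.sum_comm]
    refine Finset.sum_congr rfl fun i _ => ?_
    rw [Finset.sum_comm]
    refine Finset.sum_congr rfl fun f _ => ?_
    simp only [Matrix.mul_apply, contract, Matrix.conjTranspose_apply, Finset.mul_sum]
    rw [Finset.sum_comm]
  have h2 : (Bᴴ * B).trace.re = ∑ l, ∑ p, ‖B l p‖ ^ 2 := by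
    simp only [Matrix.trace, Matrix.diag, Matrix.mul_apply, Matrix.conjTranspose_apply]
    rw [Finset.sum_comm]
    simp only [Complex.re_sum]
    refine Finset.sum_congr rfl fun l _ => Finset.sum_congr rfl fun p _ => ?_
    rw [← Complex.normSq_eq_norm_sq, Complex.normSq_apply]
    simp
  rw [h1, h2, Complex.re_sum, Finset.mul_sum]
  exact Finset.sum_le_sum fun l _ => sum_overlap_form_le (B l)

/-- The overlap of a `k`-extendible operator with the maximally entangled state. -/
theorem trace_maxEntangled_mul_marginalAB_le {M k : ℕ} [NeZero k] (hM : 1 ≤ M)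
    {ω : Matrix (Fin M × (Fin k → Fin M)) (Fin M × (Fin k → Fin M)) ℂ} (hω : ω.PosSemidef)
    (hperm : ∀ π : Equiv.Perm (Fin k), permuteB π ω = ω) :
    (maxEntangled M * marginalAB ω).trace.re
      ≤ (1 / (M : ℝ) + 1 / (k : ℝ) - 1 / ((M : ℝ) * (k : ℝ))) * ω.trace.re := by
  have : Nonempty (Fin M) := ⟨⟨0, hM⟩⟩
  have hsum := sum_overlap_le hω
  have heq : ∀ i : Fin k, overlap i ω = overlap 0 ω := fun i => by
    have h := overlap_zero_permuteB (Equiv.swap 0 i) ω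
    rw [hperm] at h
    simpa using h.symm
  simp only [heq, Finset.sum_const, Finset.card_univ, Fintype.card_fin, nsmul_eq_mul] at hsum
  rw [← Complex.ofReal_natCast, Complex.re_ofReal_mul] at hsum
  rw [trace_maxEntangled_mul_marginalAB, ← Complex.ofReal_natCast, ← Complex.ofReal_inv,
    Complex.re_ofReal_mul]
  have hM0 : (0 : ℝ) < M := by exact_mod_cast hM
  have hk0 : (0 : ℝ) < k := by exact_mod_cast NeZero.pos k
  have hx : (overlap 0 ω).re ≤ (M + k - 1) * ω.trace.re / k := by
    rw [le_div_iff₀ hk0]; linarith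
  calc (M : ℝ)⁻¹ * (overlap 0 ω).re ≤ (M : ℝ)⁻¹ * ((M + k - 1) * ω.trace.re / k) := by gcongr
    _ = _ := by field_simp; ring

/-! ### Local maps on the reference and purification -/

/-- With `Rᴴ R = U diag(s²) Uᴴ`, take `Y = R U diag(s⁻¹)` and `T = diag(s) Uᴴ`. As `0⁻¹ = 0`, `Yᴴ Y`
is diagonal with entries `0` and `1`, hence at most `1`. -/
theorem exists_polar {m a : Type*} [Fintype m] [Fintype a] [DecidableEq a] (R : Matrix m a ℂ) :
    ∃ (Y : Matrix m a ℂ) (T : Matrix a a ℂ),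
      R = Y * T ∧ Tᴴ * T = Rᴴ * R ∧ (1 - Yᴴ * Y).PosSemidef := by
  have hP : (Rᴴ * R).PosSemidef := posSemidef_conjTranspose_mul_self R
  have hG := hP.isHermitian
  set U : Matrix a a ℂ := (hG.eigenvectorUnitary : Matrix a a ℂ) with hU
  set lam := hG.eigenvalues with hlam
  have hlam0 : ∀ i, 0 ≤ lam i := hP.eigenvalues_nonneg
  have hUU : Uᴴ * U = 1 := Unitary.coe_star_mul_self hG.eigenvectorUnitary
  have hUU' : U * Uᴴ = 1 := Unitary.coe_mul_star_self hG.eigenvectorUnitary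
  have hspec : Rᴴ * R = U * diagonal (fun i => (lam i : ℂ)) * Uᴴ := by
    conv_lhs => rw [hG.spectral_theorem, Unitary.conjStarAlgAut_apply]
    rfl
  have hV : (R * U)ᴴ * (R * U) = diagonal (fun i => (lam i : ℂ)) := by
    calc (R * U)ᴴ * (R * U) = Uᴴ * (Rᴴ * R) * U := by
          simp only [conjTranspose_mul, Matrix.mul_assoc]
      _ = (Uᴴ * U) * diagonal (fun i => (lam i : ℂ)) * (Uᴴ * U) := by
          rw [hspec]; simp only [Matrix.mul_assoc]
      _ = _ := by rw [hUU]; simp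
  set s : a → ℝ := fun i => Real.sqrt (lam i) with hs
  have hss : ∀ i, s i * s i = lam i := fun i => Real.mul_self_sqrt (hlam0 i)
  -- Where `s j = 0`, the `j`-th column of `R U` has zero norm, so nothing is lost to `0⁻¹ = 0`.
  have hfix : R * U * diagonal (fun i => (((s i)⁻¹ * s i : ℝ) : ℂ)) = R * U := by
    ext i j
    rw [Matrix.mul_diagonal]
    by_cases h : s j = 0
    · have hl : lam j = 0 := by rw [← hss, h, zero_mul]
      have h1 := congrFun (congrFun hV j) j
      rw [diagonal_apply_eq, hl, Matrix.mul_apply] at h1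
      simp only [conjTranspose_apply, ← Complex.normSq_eq_conj_mul_self, Complex.star_def] at h1
      rw [← Complex.ofReal_sum, Complex.ofReal_inj,
        Finset.sum_eq_zero_iff_of_nonneg fun _ _ => Complex.normSq_nonneg _] at h1
      rw [Complex.normSq_eq_zero.mp (h1 i (Finset.mem_univ i)), zero_mul]
    · simp [h]
  refine ⟨R * U * diagonal (fun i => (((s i)⁻¹ : ℝ) : ℂ)),
    diagonal (fun i => ((s i : ℝ) : ℂ)) * Uᴴ, ?_, ?_, ?_⟩
  · rw [← Matrix.mul_assoc, Matrix.mul_assoc (R * U), diagonal_mul_diagonal]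
    simp only [← Complex.ofReal_mul]
    rw [hfix, Matrix.mul_assoc, hUU', Matrix.mul_one]
  · rw [hspec, conjTranspose_mul, conjTranspose_conjTranspose, diagonal_conjTranspose,
      ← Matrix.mul_assoc, Matrix.mul_assoc U, diagonal_mul_diagonal]
    congr 3
    ext i
    simp [← hss]
  · rw [conjTranspose_mul, Matrix.mul_assoc, ← Matrix.mul_assoc _ (R * U), hV,
      diagonal_conjTranspose, diagonal_mul_diagonal, diagonal_mul_diagonal, ← diagonal_one,
      diagonal_sub]
    refine PosSemidef.diagonal fun i => ?_
    simp only [Pi.star_apply, Complex.star_def, Complex.conj_ofReal, ← hss, Pi.zero_apply]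
    norm_cast
    by_cases h : s i = 0
    · simp [h]
    · field_simp
      simp

/-- The action on the left system of the completely positive map whose Kraus operators are
stacked in the matrix `Y`. -/
noncomputable def leftMap {l r a b : Type*} [Fintype l] [Fintype a]
    (Y : Matrix (l × r) a ℂ) :
    Matrix (a × b) (a × b) ℂ →ₗ[ℂ] Matrix (r × b) (r × b) ℂ where
  toFun X := Matrix.of fun p q =>
    ∑ i, ∑ x, ∑ y, Y (i, p.1) x * star (Y (i, q.1) y) * X (x, p.2) (y, q.2)
  map_add' X X' := by
    ext p q
    simp [mul_add, Finset.sum_add_distrib]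
  map_smul' c X := by
    ext p q
    simp [Finset.mul_sum, mul_left_comm]

theorem leftMap_apply {l r a b : Type*} [Fintype l] [Fintype a]
    (Y : Matrix (l × r) a ℂ) (X : Matrix (a × b) (a × b) ℂ) (p q : r × b) :
    leftMap Y X p q
      = ∑ i, ∑ x, ∑ y, Y (i, p.1) x * star (Y (i, q.1) y) * X (x, p.2) (y, q.2) :=
  rfl

open scoped Kronecker in
theorem leftMap_eq_sum {l r a b : Type*} [Fintype l] [Fintype a] [Fintype b] [DecidableEq b]
    (Y : Matrix (l × r) a ℂ) (X : Matrix (a × b) (a × b) ℂ) :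
    leftMap Y X = ∑ i, ((Y ⊗ₖ (1 : Matrix b b ℂ)) * X * (Y ⊗ₖ (1 : Matrix b b ℂ))ᴴ).submatrix
      (fun p => ((i, p.1), p.2)) (fun p => ((i, p.1), p.2)) := by
  ext p q
  rw [leftMap_apply, Matrix.sum_apply]
  refine Finset.sum_congr rfl fun i _ => ?_
  simp only [Matrix.submatrix_apply, Matrix.mul_apply, Fintype.sum_prod_type,
    Matrix.kroneckerMap_apply, Matrix.conjTranspose_apply, Matrix.one_apply, mul_ite, mul_one,
    mul_zero, ite_mul, zero_mul, apply_ite star, star_zero, Finset.sum_ite_eq, Finset.mem_univ,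
    if_true, Finset.sum_mul]
  rw [Finset.sum_comm]
  exact Finset.sum_congr rfl fun y _ => Finset.sum_congr rfl fun x _ => by ring

theorem leftMap_posSemidef {l r a b : Type*} [Fintype l] [Fintype r] [Fintype a] [Fintype b]
    [DecidableEq b] (Y : Matrix (l × r) a ℂ) {X : Matrix (a × b) (a × b) ℂ} (hX : X.PosSemidef) :
    (leftMap Y X).PosSemidef := by
  rw [leftMap_eq_sum]
  exact posSemidef_sum _ fun i _ => (hX.mul_mul_conjTranspose_same _).submatrix _

open scoped Kronecker in
-- The adjoint map sends `1` to `Yᴴ Y ⊗ 1 ≤ 1`.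
theorem trace_leftMap_le {l r a b : Type*} [Fintype l] [Fintype r] [Fintype a] [DecidableEq a]
    [Fintype b] [DecidableEq b] {Y : Matrix (l × r) a ℂ} (hY : (1 - Yᴴ * Y).PosSemidef)
    {X : Matrix (a × b) (a × b) ℂ} (hX : X.PosSemidef) :
    (leftMap Y X).trace ≤ X.trace := by
  have h1 : (leftMap Y X).trace = (((Yᴴ * Y) ⊗ₖ (1 : Matrix b b ℂ)) * X).trace := by
    have : (Yᴴ * Y) ⊗ₖ (1 : Matrix b b ℂ)
        = (Y ⊗ₖ (1 : Matrix b b ℂ))ᴴ * (Y ⊗ₖ (1 : Matrix b b ℂ)) := by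
      rw [conjTranspose_kronecker, ← mul_kronecker_mul]; simp
    rw [this, Matrix.mul_assoc, Matrix.trace_mul_comm, leftMap_eq_sum, Matrix.trace_sum]
    simp only [Matrix.trace, Matrix.diag, Matrix.submatrix_apply, Fintype.sum_prod_type]
  have h2 := trace_mul_nonneg (hY.kronecker (PosSemidef.one (n := b) (R := ℂ))) hX
  have h3 : (1 - Yᴴ * Y) ⊗ₖ (1 : Matrix b b ℂ) = 1 - (Yᴴ * Y) ⊗ₖ (1 : Matrix b b ℂ) := by
    rw [eq_sub_iff_add_eq, ← add_kronecker, sub_add_cancel, one_kronecker_one]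
  rw [h3, Matrix.sub_mul, Matrix.trace_sub, Matrix.one_mul, sub_nonneg] at h2
  rwa [h1]

theorem applyRight_leftMap {l r a b c : Type*} [Fintype l] [Fintype a]
    (Y : Matrix (l × r) a ℂ) (N : Matrix b b ℂ →ₗ[ℂ] Matrix c c ℂ)
    (X : Matrix (a × b) (a × b) ℂ) :
    applyRight N (leftMap Y X) = leftMap Y (applyRight N X) := by
  ext p q
  have h : (Matrix.of fun x y => leftMap Y X (p.1, x) (q.1, y))
      = ∑ i, ∑ x, ∑ y, (Y (i, p.1) x * star (Y (i, q.1) y)) •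
        (Matrix.of fun u v => X (x, u) (y, v)) := by
    ext u v
    simp [leftMap_apply, Matrix.sum_apply]
  rw [applyRight, Matrix.of_apply, h, leftMap_apply]
  simp only [map_sum, map_smul, Matrix.sum_apply, Matrix.smul_apply, smul_eq_mul]
  rfl

theorem permuteB_leftMap {l r a b : Type*} [Fintype l] [Fintype a] {k : ℕ}
    (Y : Matrix (l × r) a ℂ) (π : Equiv.Perm (Fin k))
    (ω : Matrix (a × (Fin k → b)) (a × (Fin k → b)) ℂ) :
    permuteB π (leftMap Y ω) = leftMap Y (permuteB π ω) :=
  rfl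

theorem marginalAB_leftMap {l r a b : Type*} [Fintype l] [Fintype a] [Fintype b] [DecidableEq b]
    {k : ℕ} [NeZero k] (Y : Matrix (l × r) a ℂ)
    (ω : Matrix (a × (Fin k → b)) (a × (Fin k → b)) ℂ) :
    marginalAB (leftMap Y ω) = leftMap Y (marginalAB ω) := by
  ext p q
  simp only [marginalAB, Matrix.of_apply, leftMap_apply, Finset.mul_sum, mul_ite, mul_zero]
  rw [← Finset.sum_filter, Finset.sum_comm]
  refine Finset.sum_congr rfl fun i _ => ?_
  rw [Finset.sum_comm]
  refine Finset.sum_congr rfl fun x _ => ?_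
  rw [Finset.sum_comm]
  exact Finset.sum_congr rfl fun y _ => by rw [Finset.sum_filter]

/-- Every bipartite state is obtained from a pure state with reference `R ≃ A` by a local
trace-nonincreasing map on the reference. -/
theorem exists_pure_leftMap_eq {r a : Type*} [Fintype r] [DecidableEq r] [Fintype a]
    [DecidableEq a] {ρ : Matrix (r × a) (r × a) ℂ} (hρ : IsState ρ) :
    ∃ (Y : Matrix ((r × a) × r) a ℂ) (ψ : Matrix (a × a) (a × a) ℂ),
      (1 - Yᴴ * Y).PosSemidef ∧ IsPureState ψ ∧ leftMap Y ψ = ρ := by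
  obtain ⟨B, hB⟩ := exists_eq_conjTranspose_mul_self hρ.1
  -- The factor `B` purifies `ρ`, its row index being the purifying system. Read as a matrix from
  -- `a` to purifier and `r`, the purification factors through a square `T`, the vector of the pure
  -- state; the purifier becomes the Kraus index of `Y`.
  obtain ⟨Y, T, hR, hT, hY⟩ :=
    exists_polar (Matrix.of fun (p : (r × a) × r) y => star (B p.1 (p.2, y)))
  refine ⟨Y, _, hY, ⟨fun p => T p.1 p.2, ?_, rfl⟩, ?_⟩
  · have h1 : ((∑ p : a × a, ‖T p.1 p.2‖ ^ 2 : ℝ) : ℂ) = (Tᴴ * T).trace := by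
      simp only [Matrix.trace, Matrix.diag, Matrix.mul_apply, conjTranspose_apply,
        Fintype.sum_prod_type_right]
      push_cast
      simp [Complex.conj_mul']
    have h2 : (Tᴴ * T).trace = ρ.trace := by
      rw [hT, hB]
      simp only [Matrix.trace, Matrix.diag, Matrix.mul_apply, conjTranspose_apply, Matrix.of_apply,
        star_star]
      rw [Fintype.sum_prod_type_right]
      refine Finset.sum_congr rfl fun y _ => ?_
      rw [Fintype.sum_prod_type_right]
      exact Finset.sum_congr rfl fun m _ => Finset.sum_congr rfl fun i _ => mul_comm _ _
    rw [h2, hρ.2] at h1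
    exact_mod_cast h1
  · ext p q
    rw [leftMap_apply, hB, Matrix.mul_apply]
    refine Finset.sum_congr rfl fun i _ => ?_
    have h1 : ∀ m y, star (B i (m, y)) = ∑ x, Y (i, m) x * T x y := fun m y => by
      have := congrFun (congrFun hR (i, m)) y
      rwa [Matrix.mul_apply, Matrix.of_apply] at this
    rw [conjTranspose_apply, ← star_star (B i q), h1 p.1 p.2, h1 q.1 q.2, star_sum,
      Finset.sum_mul_sum]
    refine Finset.sum_congr rfl fun x _ => Finset.sum_congr rfl fun y _ => ?_
    simp only [vecMulVec, Matrix.of_apply, Pi.star_apply, star_mul']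
    ring

/-! ### Extendible channels and the type II error -/

theorem marginalAB_smul {a b : Type*} [Fintype b] [DecidableEq b] {k : ℕ} [NeZero k] (c : ℂ)
    (ω : Matrix (a × (Fin k → b)) (a × (Fin k → b)) ℂ) :
    marginalAB (c • ω) = c • marginalAB ω := by
  ext p q
  simp [marginalAB, Finset.mul_sum]

theorem IsKExtendibleChannel.exists_extension {a b a' b' : Type*} [Fintype a] [Fintype b]
    [DecidableEq b] [Fintype a'] [Fintype b'] [DecidableEq b'] {k : ℕ} [NeZero k]
    {K : Matrix (a × b) (a × b) ℂ →ₗ[ℂ] Matrix (a' × b') (a' × b') ℂ}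
    (hK : IsKExtendibleChannel k K) {θ : Matrix (a × (Fin k → b)) (a × (Fin k → b)) ℂ}
    (hθ : θ.PosSemidef) (hperm : ∀ π : Equiv.Perm (Fin k), permuteB π θ = θ) :
    ∃ ω : Matrix (a' × (Fin k → b')) (a' × (Fin k → b')) ℂ, ω.PosSemidef ∧
      (∀ π : Equiv.Perm (Fin k), permuteB π ω = ω) ∧ K (marginalAB θ) = marginalAB ω ∧
      ω.trace = θ.trace := by
  obtain ⟨-, L, hL, hcov, hmarg⟩ := hK
  -- Extendibility of a channel is tested on states only, so a nonzero `θ` is normalised first;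
  -- trace zero means `θ = 0`.
  by_cases ht : θ.trace = 0
  · rw [hθ.trace_eq_zero_iff] at ht
    have h0 : marginalAB θ = 0 := by ext; simp [ht, marginalAB]
    exact ⟨0, PosSemidef.zero, fun π => by ext; simp [permuteB],
      by rw [h0, map_zero]; ext; simp [marginalAB], by simp [ht]⟩
  · have hst : IsState ((θ.trace)⁻¹ • θ) :=
      ⟨hθ.smul (inv_nonneg.mpr hθ.trace_nonneg), by simp [Matrix.trace_smul, ht]⟩
    have hinv : ∀ π : Equiv.Perm (Fin k), permuteB π ((θ.trace)⁻¹ • θ) = (θ.trace)⁻¹ • θ := by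
      intro π
      exact congrArg (θ.trace⁻¹ • ·) (hperm π)
    refine ⟨L θ, hL.1.posSemidef hθ, fun π => ?_, ?_, hL.2 θ⟩
    · have := hcov π _ hst
      rw [hinv, map_smul] at this
      have h2 : permuteB π ((θ.trace)⁻¹ • L θ) = (θ.trace)⁻¹ • permuteB π (L θ) := rfl
      rw [h2] at this
      exact (smul_right_injective _ (inv_ne_zero ht) this).symm
    · have := hmarg _ hst
      rw [marginalAB_smul, map_smul, map_smul, marginalAB_smul] at this
      exact smul_right_injective _ (inv_ne_zero ht) this

theorem posSemidef_one_sub_maxEntangled {M : ℕ} (hM : 1 ≤ M) :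
    (1 - maxEntangled M).PosSemidef := by
  have h := posSemidef_conjTranspose_mul_self (1 - maxEntangled M)
  rwa [conjTranspose_sub, conjTranspose_one, (posSemidef_maxEntangled M).isHermitian.eq,
    Matrix.mul_sub, Matrix.sub_mul, Matrix.sub_mul, maxEntangled_mul_self hM, Matrix.one_mul,
    Matrix.one_mul, sub_self, sub_zero, Matrix.mul_one] at h

/-- The common core of both parts, with test `X ↦ Tr Φ K(leftMap Y X)`. A trace-nonincreasing
`leftMap` suffices because the overlap bound scales with the trace and its constant is nonnegative.
-/
theorem le_unextDiv_of_leftMap {l r a b : Type*} [Fintype l] [Fintype r] [DecidableEq r]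
    [Fintype a] [DecidableEq a] [Fintype b] [DecidableEq b]
    (k : ℕ) [NeZero k] {M : ℕ} (hM : 1 ≤ M) {ε : ℝ} {Y : Matrix (l × r) a ℂ}
    (hY : (1 - Yᴴ * Y).PosSemidef) {X : Matrix (a × b) (a × b) ℂ}
    {K : Matrix (r × b) (r × b) ℂ →ₗ[ℂ] Matrix (Fin M × Fin M) (Fin M × Fin M) ℂ}
    (hK : IsKExtendibleChannel k K)
    (hX : 1 - ε ≤ (maxEntangled M * K (leftMap Y X)).trace.re) :
    ((-Real.logb 2 (1 / (M : ℝ) + 1 / (k : ℝ) - 1 / ((M : ℝ) * (k : ℝ))) : ℝ) : EReal) ≤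
      unextDiv k ε X := by
  refine le_unextDiv_of_test k (Matrix.traceLinearMap _ ℂ ℂ ∘ₗ
    LinearMap.mulLeft ℂ (maxEntangled M) ∘ₗ K ∘ₗ leftMap Y) (fun X hX => ?_) (fun X hX => ?_) hX
    fun σ hσ => ?_
  · exact trace_mul_nonneg (posSemidef_maxEntangled M)
      (hK.1.1.posSemidef (leftMap_posSemidef Y hX))
  · have h := trace_mul_nonneg (posSemidef_one_sub_maxEntangled hM)
      (hK.1.1.posSemidef (leftMap_posSemidef Y hX))
    rw [Matrix.sub_mul, Matrix.trace_sub, Matrix.one_mul, sub_nonneg, hK.1.2] at h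
    exact h.trans (trace_leftMap_le hY hX)
  · obtain ⟨-, θ, hθ, hperm, rfl⟩ := hσ
    obtain ⟨ω, hω, hωp, hKω, htr⟩ := hK.exists_extension (leftMap_posSemidef Y hθ.1)
      fun π => by rw [permuteB_leftMap, hperm]
    have h := trace_maxEntangled_mul_marginalAB_le hM hω hωp
    rw [← hKω, marginalAB_leftMap, htr] at h
    have htr1 : (leftMap Y θ).trace.re ≤ 1 := by
      have h2 := trace_leftMap_le hY hθ.1
      rw [hθ.2] at h2
      exact (Complex.le_def.mp h2).1
    have hM1 : (1 : ℝ) ≤ M := by exact_mod_cast hM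
    have hk1 : (1 : ℝ) ≤ k := by exact_mod_cast NeZero.one_le
    have hc : 0 ≤ 1 / (M : ℝ) + 1 / (k : ℝ) - 1 / ((M : ℝ) * (k : ℝ)) := by
      have : 1 / (M : ℝ) + 1 / (k : ℝ) - 1 / ((M : ℝ) * (k : ℝ))
          = ((k : ℝ) + M - 1) / (M * k) := by field_simp
      rw [this]
      exact div_nonneg (by linarith) (by positivity)
    exact h.trans (mul_le_of_le_one_right hc htr1)

/-- Makes distillation the case of a trivial map on the reference. -/
theorem leftMap_one {a b : Type*} [Fintype a] [DecidableEq a]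
    (X : Matrix (a × b) (a × b) ℂ) :
    leftMap ((1 : Matrix a a ℂ).submatrix (Prod.snd : Unit × a → a) id) X = X := by
  ext p q
  simp [leftMap_apply, Matrix.one_apply, apply_ite]

end QInfo

theorem theorem2 {a b : Type*} [Fintype a] [DecidableEq a] [Fintype b] [DecidableEq b]
    (k : ℕ) [NeZero k] (M : ℕ) (hM : 1 ≤ M) (ε : ℝ) (hε : ε ∈ Set.Icc (0 : ℝ) 1) :
    (∀ N : Matrix a a ℂ →ₗ[ℂ] Matrix b b ℂ, QInfo.IsChannel N →
      ∀ (E : Matrix (Fin M) (Fin M) ℂ →ₗ[ℂ] Matrix a a ℂ)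
        (K : Matrix (Fin M × b) (Fin M × b) ℂ →ₗ[ℂ]
          Matrix (Fin M × Fin M) (Fin M × Fin M) ℂ),
        QInfo.IsTransmissionProtocol k M ε N E K →
          ((-Real.logb 2 (1 / (M : ℝ) + 1 / (k : ℝ) - 1 / ((M : ℝ) * (k : ℝ))) : ℝ) : EReal) ≤
            ⨆ ψ ∈ {ψ : Matrix (a × a) (a × a) ℂ | QInfo.IsPureState ψ},
              QInfo.unextDiv k ε (QInfo.applyRight N ψ)) ∧
    (∀ ρ : Matrix (a × b) (a × b) ℂ, QInfo.IsState ρ →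
      ∀ K : Matrix (a × b) (a × b) ℂ →ₗ[ℂ] Matrix (Fin M × Fin M) (Fin M × Fin M) ℂ,
        QInfo.IsDistillationProtocol k M ε ρ K →
          ((-Real.logb 2 (1 / (M : ℝ) + 1 / (k : ℝ) - 1 / ((M : ℝ) * (k : ℝ))) : ℝ) : EReal) ≤
            QInfo.unextDiv k ε ρ) := by
  refine ⟨fun N hN E K hP => ?_, fun ρ hρ K hP => ?_⟩
  · obtain ⟨hE, hK, hF⟩ := hP
    have hρ : QInfo.IsState (QInfo.applyRight E (QInfo.maxEntangled M)) :=
      ⟨hE.1 M _ (QInfo.posSemidef_maxEntangled M), by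
        rw [QInfo.trace_applyRight hE.2, QInfo.trace_maxEntangled hM]⟩
    rw [QInfo.fidelity_maxEntangled hM (hK.1.1.posSemidef (hN.1 M _ hρ.1))] at hF
    -- The pure state witnessing the supremum; `Y` moves past `N` and joins the test.
    obtain ⟨Y, ψ, hY, hψ, hYψ⟩ := QInfo.exists_pure_leftMap_eq hρ
    rw [← hYψ, QInfo.applyRight_leftMap] at hF
    exact le_iSup₂_of_le ψ hψ (QInfo.le_unextDiv_of_leftMap k hM hY hK hF)
  · obtain ⟨hK, hF⟩ := hP
    rw [QInfo.fidelity_maxEntangled hM (hK.1.1.posSemidef hρ.1), ← QInfo.leftMap_one ρ] at hF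
    refine QInfo.le_unextDiv_of_leftMap k hM ?_ hK hF
    have h : ((1 : Matrix a a ℂ).submatrix (Prod.snd : Unit × a → a) id).conjTranspose *
        (1 : Matrix a a ℂ).submatrix (Prod.snd : Unit × a → a) id = 1 := by
      ext i j
      simp [Matrix.mul_apply, Matrix.one_apply, Fintype.sum_prod_type, apply_ite]
    rw [h, sub_self]
    exact Matrix.PosSemidef.zero
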